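/- Define classes of groups $\mathfrak X_\alpha$, indexed by ordinals $\alpha$: $\mathfrak X_0$ consists of the trivial groups; $\mathfrak X_1$ consists of the virtually abelian groups; for $\alpha\ge 1$, $\mathfrak X_{\alpha+1}$ consists of the groups $G$ that have a normal subgroup $N$ all of whose finitely generated subgroups lie in $\mathfrak X_\alpha$ and for which $G/N\in\mathfrak X_1$; and $\mathfrak X_\beta=\bigcup_{\alpha<\beta}\mathfrak X_\alpha$ for limit ordinals $\beta$. A group is elementary amenable if it lies in some $\mathfrak X_\alpha$. The Hirsch length $h(G)\in\{0,1,2,\dots,\infty\}$ of an elementary amenable group is defined recursively along these classes: $h(1)=0$; if $G$ is virtually abelian, $h(G)=\dim_{\mathbb Q}(A\otimes_{\mathbb Z}\mathbb Q)$ for an abelian subgroup $A\le G$ of finite index; if every finitely generated subgroup of $N$ lies in $\mathfrak X_\alpha$, then $h(N)=\sup\{h(F) : F\le N,\ F\in\mathfrak X_\alpha\}$; and if $G\in\mathfrak X_{\alpha+1}$, with $N\trianglelefteq G$ as in the definition of $\mathfrak X_{\alpha+1}$, then $h(G)=h(N)+h(G/N)$. (The value does not depend on the choices made; formally, $h(G)$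 is the least value that the recursion can give.) A metric space $X$ has asymptotic dimension at most $n$ if for every $R>0$ there are $S>0$ and a covering of $X$ by sets of diameter at most $S$ such that every nonempty subset of $X$ of diameter at most $R$ is contained in a member of the covering, and no point lies in more than $n+1$ members. Likewise, a discrete group $G$, countable or not, has asymptotic dimension at most $n$ if for every finite $F\subseteq G$ there are a finite $F'\subseteq G$ and a covering $\mathcal U$ of $G$ such that $xy^{-1}\in F'$ whenever $x,y\in U\in\mathcal U$, every nonempty $A\subseteq G$ with $xy^{-1}\in F$ for all $x,y\in A$ is contained in a member of $\mathcal U$, and no point lies in more than $n+1$ members of $\mathcal U$. In both cases $\operatorname{asdim}$ is the least such $n\in\{0,1,2,\dots\}$, or $\infty$ if there is none. **Theorem.** Let $G$ be an elementary amenable group. Then $\operatorname{asdim}(G)\le h(G)$. In particular, for every right-invariant metric $d$ on $G$ that is proper (all closed balls are finite), $\operatorname{asdim}(G,d)\le h(G)$. -/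

import Mathlib

open scoped TensorProduct

/-! ### Asymptotic dimension -/

/-- The metric space `X` has asymptotic dimension at most `n`: for every `R > 0` there are `S > 0`
and a covering of `X` whose members have diameter at most `S`, which has Lebesgue number at least
`R` (every nonempty set of diameter at most `R` lies in a member), and which has multiplicity at
most `n + 1` (no point lies in more than `n + 1` members). -/
def MetricAsdimLE (X : Type*) [MetricSpace X] (n : ℕ) : Prop :=
  ∀ R : ℝ, 0 < R → ∃ S : ℝ, 0 < S ∧ ∃ U : Set (Set X),
    ⋃₀ U = Set.univ ∧
    (∀ u ∈ U, ∀ x ∈ u, ∀ y ∈ u, dist x y ≤ S) ∧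
    (∀ A : Set X, A.Nonempty → (∀ x ∈ A, ∀ y ∈ A, dist x y ≤ R) → ∃ u ∈ U, A ⊆ u) ∧
    (∀ x : X, {u ∈ U | x ∈ u}.encard ≤ n + 1)

/-- The asymptotic dimension of a metric space: the least `n` with `MetricAsdimLE X n`, and `⊤` if
there is none. -/
noncomputable def metricAsdim (X : Type*) [MetricSpace X] : ℕ∞ :=
  ⨅ (n : ℕ) (_ : MetricAsdimLE X n), (n : ℕ∞)

/-- The metric on the discrete group `G` is proper (closed balls are finite) and right invariant. -/
def IsProperRightInvariant (G : Type*) [Group G] [MetricSpace G] : Prop :=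
  (∀ (x : G) (r : ℝ), (Metric.closedBall x r).Finite) ∧
    ∀ x y g : G, dist (x * g) (y * g) = dist x y

/-- The discrete group `G`, countable or not, has asymptotic dimension at most `n` for its canonical
right invariant coarse structure, which is generated by the entourages `{(x, y) | x * y⁻¹ ∈ F}` with
`F` a finite subset of `G`. These play the role of the sets `{(x, y) | dist x y ≤ R}`. -/
def GroupAsdimLE (G : Type*) [Group G] (n : ℕ) : Prop :=
  ∀ F : Set G, F.Finite → ∃ F' : Set G, F'.Finite ∧ ∃ U : Set (Set G),
    ⋃₀ U = Set.univ ∧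
    (∀ u ∈ U, ∀ x ∈ u, ∀ y ∈ u, x * y⁻¹ ∈ F') ∧
    (∀ A : Set G, A.Nonempty → (∀ x ∈ A, ∀ y ∈ A, x * y⁻¹ ∈ F) → ∃ u ∈ U, A ⊆ u) ∧
    (∀ x : G, {u ∈ U | x ∈ u}.encard ≤ n + 1)

/-- The asymptotic dimension of a discrete group, for its canonical coarse structure. -/
noncomputable def groupAsdim (G : Type*) [Group G] : ℕ∞ :=
  ⨅ (n : ℕ) (_ : GroupAsdimLE G n), (n : ℕ∞)

/-! ### Elementary amenable groups -/

universe u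

/-- `G` has an abelian subgroup of finite index. -/
def IsVirtuallyAbelian (G : Type u) [Group G] : Prop :=
  ∃ A : Subgroup G, IsMulCommutative A ∧ A.FiniteIndex

/-- The class of groups `𝔛 α`, for an ordinal `α`: `𝔛 0` consists of the trivial groups, `𝔛 1` of
the virtually abelian groups, `𝔛 (α + 1)` of the groups with a normal subgroup `N` that is locally
in `𝔛 α` (all finitely generated subgroups of `N` are in `𝔛 α`) and has virtually abelian quotient,
and `𝔛 β` is the union of the earlier classes if `β` is a limit ordinal. -/
inductive ElemClass : Ordinal.{u} → (G : Type u) → [Group G] → Prop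
  | trivial (G : Type u) [Group G] (hG : Subsingleton G) : ElemClass 0 G
  | virtuallyAbelian (G : Type u) [Group G] (hG : IsVirtuallyAbelian G) : ElemClass 1 G
  | succ (α : Ordinal.{u}) (hα : 1 ≤ α) (G : Type u) [Group G] (N : Subgroup G) [N.Normal]
      (hN : ∀ F : Subgroup N, F.FG → ElemClass α F)
      (hQ : IsVirtuallyAbelian (G ⧸ N)) : ElemClass (α + 1) G
  | limit (β : Ordinal.{u}) (hβ : Order.IsSuccLimit β) (α : Ordinal.{u}) (hα : α < β)
      (G : Type u) [Group G] (hG : ElemClass α G) : ElemClass β G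

/-- `G` is elementary amenable: it belongs to the union of the classes `𝔛 α`. -/
def IsElementaryAmenable (G : Type u) [Group G] : Prop :=
  ∃ α : Ordinal.{u}, ElemClass α G

/-! ### Hirsch length -/

/-- The torsion-free rank `dim_ℚ (A ⊗ ℚ)` of an abelian group. -/
noncomputable def abelianRank (A : Type u) [CommGroup A] : ℕ∞ :=
  Cardinal.toENat (Module.rank ℚ (ℚ ⊗[ℤ] Additive A))

open IsMulCommutative in
/-- `HasHirschLengthAt α G n`: the group `G` is in `𝔛 α`, and the recursive definition of the Hirsch
length along the classes `𝔛 α` gives it the value `n`. A virtually abelian group gets the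
torsion-free rank of an abelian subgroup of finite index. For `N` locally in `𝔛 α`, `h(N)` is the
supremum of `h(F)` over the subgroups `F` of `N` that are in `𝔛 α`; and for `G` in `𝔛 (α + 1)`,
witnessed by `N`, one puts `h(G) = h(N) + h(G ⧸ N)`. -/
inductive HasHirschLengthAt : Ordinal.{u} → (G : Type u) → [Group G] → ℕ∞ → Prop
  | trivial (G : Type u) [Group G] (hG : Subsingleton G) : HasHirschLengthAt 0 G 0
  | virtuallyAbelian (G : Type u) [Group G] (A : Subgroup G) [IsMulCommutative A]
      (hA : A.FiniteIndex) : HasHirschLengthAt 1 G (abelianRank A)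
  | succ (α : Ordinal.{u}) (hα : 1 ≤ α) (G : Type u) [Group G] (N : Subgroup G) [N.Normal]
      (hN : ∀ F : Subgroup N, F.FG → ElemClass α F)
      (v : Subgroup N → ℕ∞)
      (hv : ∀ F : Subgroup N, ElemClass α F → HasHirschLengthAt α F (v F))
      (m : ℕ∞) (hm : HasHirschLengthAt 1 (G ⧸ N) m) :
      HasHirschLengthAt (α + 1) G ((⨆ (F : Subgroup N) (_ : ElemClass α F), v F) + m)
  | limit (β : Ordinal.{u}) (hβ : Order.IsSuccLimit β) (α : Ordinal.{u}) (hα : α < β)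
      (G : Type u) [Group G] (n : ℕ∞) (hG : HasHirschLengthAt α G n) : HasHirschLengthAt β G n

/-- The recursion assigns at least one value to every group in `𝔛 α`. -/
theorem ElemClass.exists_hasHirschLengthAt (α : Ordinal.{u}) :
    ∀ (G : Type u) [Group G], ElemClass α G → ∃ n, HasHirschLengthAt α G n := by
  induction α using WellFoundedLT.induction with
  | ind α ih =>
    intro G _ hG
    cases hG with
    | trivial _ h => exact ⟨_, .trivial G h⟩
    | virtuallyAbelian _ h =>
      obtain ⟨A, hA, hfin⟩ := h
      exact ⟨_, .virtuallyAbelian G A hfin⟩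
    | succ γ hγ _ N hN hQ =>
      classical
      obtain ⟨A, hA, hfin⟩ := hQ
      have h : ∀ F : Subgroup N, ∃ n, ElemClass γ F → HasHirschLengthAt γ F n := by
        intro F
        by_cases hF : ElemClass γ F
        · obtain ⟨n, hn⟩ := ih γ (Order.lt_add_one_iff.2 le_rfl) F hF
          exact ⟨n, fun _ => hn⟩
        · exact ⟨0, fun h => absurd h hF⟩
      choose v hv using h
      exact ⟨_, .succ γ hγ G N hN v hv _ (.virtuallyAbelian (G ⧸ N) A hfin)⟩
    | limit _ hβ γ hγ _ h =>
      obtain ⟨n, hn⟩ := ih γ hγ G h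
      exact ⟨n, .limit α hβ γ hγ G n hn⟩

/-- The Hirsch length `h(G)` of an elementary amenable group `G`: the value that the recursion gives.
The value does not depend on the choices of abelian subgroups of finite index, of the subgroups `N`
and of `α` (and there is one, by `ElemClass.exists_hasHirschLengthAt`), so that the infimum below is
over a one-element set; an infimum is taken only in order to name the value without proving this. -/
noncomputable def hirschLength (G : Type u) [Group G] : ℕ∞ :=
  sInf {n : ℕ∞ | ∃ α : Ordinal.{u}, HasHirschLengthAt α G n}

/-! The induction carries more than multiplicity `n + 1`: the covers also split into `2 ^ n`
disjoint families, the colours, a number that does not depend on the scale. This property passes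
from finitely generated subgroups to the group (`hasColoredCovers_of_fg`) and from subgroups of
finite index to the group (`HasColoredCovers.of_finiteIndex`).

The crux is an extension by `ℤ` (`HasColoredCovers.of_ker_int`). Covers of the kernel spread to
slabs of `G`. Two interleaved systems of slabs must be merged at the cost of one in multiplicity.
The second cover is coarse enough to swallow each piece of the first within a slab, and each colour
of the first is handed over in its own window of heights. As the number of colours is known before
the covers, the slabs can be made thick enough for disjoint windows. Hence at any point at most one
colour is counted twice. The number of colours doubles.

A finitely generated subgroup of `ℚ` is cyclic, so locality gives quotients inside `ℚ`, then inside
`ℚ ^ r`. An abelian group maps to its rationalization with torsion kernel, and torsion quotients are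
locally finite, hence free of cost. Induction on a derivation of the Hirsch length concludes. -/

/-! ### Coloured covers and asymptotic dimension -/

/-- A labelling `ℓ` of the points of `G`, one partial labelling for each colour in `C`, is regarded
as the cover of `G` by the sets `{x | ℓ c x = some i}`. It is an `m`-fold cover of scale `F` bounded
by `F'` if these sets are `F'`-bounded, every ball `F * x` lies in one of them, and every point has
labels in at most `m` colours. -/
structure IsColoredCover {G : Type*} [Group G] {C : Type*} [Fintype C] {ι : Type*}
    (F F' : Set G) (m : ℕ) (ℓ : C → G → Option ι) : Prop where
  bounded : ∀ c x y i, ℓ c x = some i → ℓ c y = some i → x * y⁻¹ ∈ F'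
  lebesgue : ∀ x, ∃ c i, ∀ f ∈ F, ℓ c (f * x) = some i
  card_le : ∀ x, (Finset.univ.filter fun c => (ℓ c x).isSome).card ≤ m

/-- At every finite scale, `G` has a bounded cover of multiplicity at most `n + 1` that splits into
`2 ^ n` disjoint families. -/
def HasColoredCovers (n : ℕ) (G : Type u) [Group G] : Prop :=
  ∀ F : Set G, F.Finite → ∃ F' : Set G, F'.Finite ∧
    ∃ (ι : Type u) (ℓ : Fin (2 ^ n) → G → Option ι), IsColoredCover F F' (n + 1) ℓ

theorem IsColoredCover.extend {G : Type*} [Group G] {C D : Type*} [Fintype C] [Fintype D]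
    {ι : Type*} {F F' : Set G} {m : ℕ} {ℓ : C → G → Option ι} (h : IsColoredCover F F' m ℓ)
    (e : C ↪ D) :
    IsColoredCover F F' m (Function.extend e ℓ fun _ _ => none) := by
  classical
  have key : ∀ d x i, Function.extend e ℓ (fun _ _ => none) d x = some i →
      ∃ c, e c = d ∧ ℓ c x = some i := by
    intro d x i hd
    by_cases hc : ∃ c, e c = d
    · obtain ⟨c, rfl⟩ := hc
      rw [e.injective.extend_apply] at hd
      exact ⟨c, rfl, hd⟩
    · rw [Function.extend_apply' _ _ _ hc] at hd
      cases hd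
  refine ⟨fun d x y i hx hy => ?_, fun x => ?_, fun x => ?_⟩
  · obtain ⟨c, rfl, hc⟩ := key d x i hx
    rw [e.injective.extend_apply] at hy
    exact h.bounded c x y i hc hy
  · obtain ⟨c, i, hc⟩ := h.lebesgue x
    exact ⟨e c, i, by simpa only [e.injective.extend_apply] using hc⟩
  · refine le_trans ?_ (h.card_le x)
    rw [← Finset.card_map e]
    refine Finset.card_le_card fun d hd => ?_
    obtain ⟨i, hi⟩ := Option.isSome_iff_exists.1 (Finset.mem_filter.1 hd).2
    obtain ⟨c, rfl, hc⟩ := key d x i hi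
    simp [hc]

theorem HasColoredCovers.mono {G : Type u} [Group G] {m n : ℕ} (h : HasColoredCovers m G)
    (hmn : m ≤ n) : HasColoredCovers n G := by
  intro F hF
  obtain ⟨F', hF', ι, ℓ, hℓ⟩ := h F hF
  obtain ⟨h1, h2, h3⟩ := hℓ.extend
    (Fin.castLEEmb (Nat.pow_le_pow_right two_pos hmn : 2 ^ m ≤ 2 ^ n))
  exact ⟨F', hF', ι, _, h1, h2, fun x => (h3 x).trans (by lia)⟩

theorem hasColoredCovers_of_subsingleton (G : Type u) [Group G] [Subsingleton G] :
    HasColoredCovers 0 G := by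
  intro F hF
  refine ⟨Set.univ, Set.toFinite _, PUnit, fun _ _ => some PUnit.unit, ?_, ?_, ?_⟩
  · simp
  · exact fun x => ⟨0, PUnit.unit, by simp⟩
  · simp

theorem HasColoredCovers.of_injective {G H : Type u} [Group G] [Group H] {n : ℕ}
    (h : HasColoredCovers n G) (φ : H →* G) (hφ : Function.Injective φ) :
    HasColoredCovers n H := by
  intro F hF
  obtain ⟨F', hF', ι, ℓ, h1, h2, h3⟩ := h (φ '' F) (hF.image φ)
  refine ⟨φ ⁻¹' F', hF'.preimage hφ.injOn, ι, fun c x => ℓ c (φ x), ?_, ?_, fun x => h3 _⟩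
  · intro c x y i hx hy
    simpa using h1 c _ _ i hx hy
  · intro x
    obtain ⟨c, i, hc⟩ := h2 (φ x)
    exact ⟨c, i, fun f hf => by simpa using hc _ (Set.mem_image_of_mem φ hf)⟩

theorem HasColoredCovers.groupAsdimLE {G : Type u} [Group G] {n : ℕ} (h : HasColoredCovers n G) :
    GroupAsdimLE G n := by
  intro F hF
  -- With `1` in the scale, the set containing the ball around `x` contains `x` itself.
  obtain ⟨F', hF', ι, ℓ, h1, h2, h3⟩ := h (insert 1 F) (hF.insert 1)
  refine ⟨F', hF', {u | ∃ c i, u = {x | ℓ c x = some i}}, ?_, ?_, ?_, ?_⟩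
  · refine Set.eq_univ_of_forall fun x => ?_
    obtain ⟨c, i, hc⟩ := h2 x
    exact ⟨_, ⟨c, i, rfl⟩, by simpa using hc 1 (Set.mem_insert _ _)⟩
  · rintro _ ⟨c, i, rfl⟩ x hx y hy
    exact h1 c x y i hx hy
  · rintro A ⟨a, ha⟩ hA
    obtain ⟨c, i, hc⟩ := h2 a
    refine ⟨_, ⟨c, i, rfl⟩, fun x hx => ?_⟩
    simpa using hc _ (Set.mem_insert_of_mem _ (hA x hx a ha))
  · intro x
    have hsub : {u ∈ {u : Set G | ∃ c i, u = {x | ℓ c x = some i}} | x ∈ u} ⊆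
        (fun c => {y | ℓ c y = ℓ c x}) ''
          (Finset.univ.filter fun c => (ℓ c x).isSome : Finset _) := by
      rintro _ ⟨⟨c, i, rfl⟩, hx⟩
      have hx : ℓ c x = some i := hx
      exact ⟨c, by simp [hx], by simp [hx]⟩
    refine (Set.encard_le_encard hsub).trans ((Set.encard_image_le _ _).trans ?_)
    rw [Set.encard_coe_eq_coe_finsetCard]
    exact_mod_cast h3 x

theorem GroupAsdimLE.metricAsdimLE {G : Type*} [Group G] [MetricSpace G] {n : ℕ}
    (h : GroupAsdimLE G n) (hG : IsProperRightInvariant G) : MetricAsdimLE G n := by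
  have hdist : ∀ x y : G, dist (x * y⁻¹) 1 = dist x y := fun x y => by
    simpa using hG.2 x y y⁻¹
  intro R _
  obtain ⟨F', hF', U, hU, hb, hl, hm⟩ := h _ (hG.1 1 R)
  obtain ⟨S, hS⟩ := (hF'.image fun x => dist x 1).bddAbove
  refine ⟨max S 1, by positivity, U, hU, ?_, ?_, hm⟩
  · intro u hu x hx y hy
    rw [← hdist]
    exact (hS ⟨_, hb u hu x hx y hy, rfl⟩).trans (le_max_left _ _)
  · intro A hA hAR
    refine hl A hA fun x hx y hy => ?_
    rw [Metric.mem_closedBall, hdist]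
    exact hAR x hx y hy

/-! ### Local and finite-index permanence -/

/-- Having coloured covers is a local property. -/
theorem hasColoredCovers_of_fg {G : Type u} [Group G] {n : ℕ}
    (h : ∀ H : Subgroup G, H.FG → HasColoredCovers n H) : HasColoredCovers n G := by
  intro F hF
  let H := Subgroup.closure F
  obtain ⟨F', hF', ι, ℓ, h1, h2, h3⟩ := h H ((Subgroup.fg_iff _).2 ⟨F, rfl, hF⟩) ((↑) ⁻¹' F)
    (hF.preimage Subtype.val_injective.injOn)
  -- Left multiplication by `F` preserves each right coset of `H`, and right translation identifies
  -- the coset with `H` without changing any `x * y⁻¹`. So one cover of `H` serves all cosets, with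
  -- the coset added to the label.
  let s : Setoid G := QuotientGroup.rightRel H
  have hs : ∀ x, x * ((⟦x⟧ : Quotient s).out)⁻¹ ∈ H := fun x =>
    QuotientGroup.rightRel_apply.1 (Quotient.mk_out (s := s) x)
  refine ⟨Subtype.val '' F', hF'.image _, Quotient s × ι,
    fun c x => (ℓ c ⟨_, hs x⟩).map fun i => (⟦x⟧, i), ?_, ?_, ?_⟩
  · rintro c x y ⟨q, i⟩ hx hy
    simp only [Option.map_eq_some_iff, Prod.mk.injEq] at hx hy
    obtain ⟨_, hx, hxq, rfl⟩ := hx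
    obtain ⟨_, hy, hyq, rfl⟩ := hy
    refine ⟨_, h1 c _ _ _ hx hy, ?_⟩
    simp [hxq, hyq]
  · intro x
    obtain ⟨c, i, hc⟩ := h2 ⟨_, hs x⟩
    refine ⟨c, (⟦x⟧, i), fun f hf => ?_⟩
    have hfH : f ∈ H := Subgroup.subset_closure hf
    have hq : (⟦f * x⟧ : Quotient s) = ⟦x⟧ := by
      refine Quotient.sound (QuotientGroup.rightRel_apply.2 ?_)
      simpa using hfH
    have := hc ⟨f, hfH⟩ hf
    simp only [Option.map_eq_some_iff, Prod.mk.injEq]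
    refine ⟨i, ?_, hq, rfl⟩
    rw [← this]
    congr 1
    ext
    simp [hq, mul_assoc]
  · intro x
    simpa using h3 _

open scoped Pointwise in
-- The map `x ↦ (s x)⁻¹ * x` into `H` multiplies on the left by one of finitely many elements, so it
-- moves points a bounded distance and the cover of `H` pulls back.
theorem HasColoredCovers.of_finiteIndex {G : Type u} [Group G] {n : ℕ} {H : Subgroup G}
    (h : HasColoredCovers n H) (hH : H.FiniteIndex) : HasColoredCovers n G := by
  intro F hF
  let s : G → G := fun x => (x : G ⧸ H).out
  have hfin : (Set.range s).Finite :=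
    (Set.finite_range fun q : G ⧸ H => q.out).subset (by rintro _ ⟨x, rfl⟩; exact ⟨_, rfl⟩)
  have hs : ∀ x, (s x)⁻¹ * x ∈ H := fun x =>
    QuotientGroup.eq.1 (QuotientGroup.out_eq' (x : G ⧸ H))
  obtain ⟨F', hF', ι, ℓ, h1, h2, h3⟩ := h ((↑) ⁻¹' ((Set.range s)⁻¹ * F * Set.range s))
    (((hfin.inv.mul hF).mul hfin).preimage Subtype.val_injective.injOn)
  refine ⟨Set.range s * ((↑) '' F') * (Set.range s)⁻¹, (hfin.mul (hF'.image _)).mul hfin.inv, ι,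
    fun c x => ℓ c ⟨_, hs x⟩, ?_, ?_, fun x => h3 _⟩
  · intro c x y i hx hy
    refine ⟨s x * _, ⟨s x, ⟨x, rfl⟩, _, ⟨_, h1 c _ _ i hx hy, rfl⟩, rfl⟩, (s y)⁻¹,
      Set.inv_mem_inv.2 ⟨y, rfl⟩, ?_⟩
    simp [mul_assoc]
  · intro x
    obtain ⟨c, i, hc⟩ := h2 ⟨_, hs x⟩
    refine ⟨c, i, fun f hf => ?_⟩
    have hmem : (s (f * x))⁻¹ * f * s x ∈ H := by
      simpa [mul_assoc] using H.mul_mem (hs (f * x)) (H.inv_mem (hs x))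
    rw [← hc ⟨_, hmem⟩ ⟨_, ⟨_, Set.inv_mem_inv.2 ⟨f * x, rfl⟩, f, hf, rfl⟩, _, ⟨x, rfl⟩, rfl⟩]
    congr 1
    ext
    simp [mul_assoc]

/-! ### Extensions by the integers -/

section IntegerQuotient

variable {G : Type u} [Group G]

open scoped Pointwise in
/-- If the kernel of `φ : G → ℤ` has coloured covers, then the slabs of `G` between the heights
`T * j - a` and `T * (j + 1) - a` have coloured covers, uniformly in `j`. -/
theorem HasColoredCovers.exists_slab_cover {n : ℕ} (φ : G →* Multiplicative ℤ) (t : G)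
    (ht : (φ t).toAdd = 1) (h : HasColoredCovers n φ.ker) {F : Set G} (hF : F.Finite) {T : ℤ}
    (hT : 0 < T) (a : ℤ) :
    ∃ F' : Set G, F'.Finite ∧ ∃ (ι : Type u) (ℓ : Fin (2 ^ n) → G → Option ι),
      (∀ c x y i, ℓ c x = some i → ℓ c y = some i → x * y⁻¹ ∈ F') ∧
      (∀ x, ∃ c i, ∀ f ∈ F, ((φ (f * x)).toAdd + a) / T = ((φ x).toAdd + a) / T →
        ℓ c (f * x) = some i) ∧
      (∀ x, (Finset.univ.filter fun c => (ℓ c x).isSome).card ≤ n + 1) := by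
  let j : G → ℤ := fun x => ((φ x).toAdd + a) / T
  let r : G → ℤ := fun x => ((φ x).toAdd + a) % T
  have hjr : ∀ x, (φ x).toAdd = r x + (T * j x - a) := fun x => by
    have := Int.emod_add_mul_ediv ((φ x).toAdd + a) T
    simp only [r, j]
    linarith
  -- The right factor depends only on the slab, so it cancels in `x * y⁻¹`; the left factor is a
  -- bounded move, since `0 ≤ r x < T`. This makes the bounds uniform in the slab.
  let p : G → G := fun x => t ^ (-r x) * x * t ^ (-(T * j x - a))
  have hp : ∀ x, p x ∈ φ.ker := fun x => by
    apply Multiplicative.toAdd.injective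
    simp only [p, map_mul, map_zpow, toAdd_mul, toAdd_zpow, ht, toAdd_one, hjr x, smul_eq_mul]
    ring
  let D : Set G := (fun k : ℤ => t ^ k) '' Set.Icc (-T) T
  have hD : D.Finite := (Set.finite_Icc _ _).image _
  have hr : ∀ x, t ^ (r x) ∈ D ∧ t ^ (-r x) ∈ D := fun x => by
    have h0 := Int.emod_nonneg ((φ x).toAdd + a) hT.ne'
    have h1 := Int.emod_lt_of_pos ((φ x).toAdd + a) hT
    exact ⟨⟨_, ⟨by simp only [r]; linarith, by simp only [r]; linarith⟩, rfl⟩,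
      ⟨_, ⟨by simp only [r]; linarith, by simp only [r]; linarith⟩, rfl⟩⟩
  obtain ⟨F', hF', ι, ℓ, h1, h2, h3⟩ := h ((↑) ⁻¹' (D * F * D))
    (((hD.mul hF).mul hD).preimage Subtype.val_injective.injOn)
  refine ⟨D * (Subtype.val '' F') * D, (hD.mul (hF'.image _)).mul hD, ULift.{u} ℤ × ι,
    fun c x => (ℓ c ⟨_, hp x⟩).map fun i => (⟨j x⟩, i), ?_, ?_, ?_⟩
  · rintro c x y ⟨⟨k⟩, i⟩ hx hy
    simp only [Option.map_eq_some_iff, Prod.mk.injEq, ULift.up.injEq] at hx hy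
    obtain ⟨_, hx, hxj, rfl⟩ := hx
    obtain ⟨_, hy, hyj, rfl⟩ := hy
    refine ⟨_, ⟨_, (hr x).1, _, ⟨_, h1 c _ _ _ hx hy, rfl⟩, rfl⟩, _, (hr y).2, ?_⟩
    simp only [Subgroup.coe_mul, Subgroup.coe_inv, p, hxj, hyj]
    group
  · intro x
    obtain ⟨c, i, hc⟩ := h2 ⟨_, hp x⟩
    refine ⟨c, (⟨j x⟩, i), fun f hf hj => ?_⟩
    have hj : j (f * x) = j x := hj
    have heq : p (f * x) = t ^ (-r (f * x)) * f * t ^ (r x) * p x := by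
      simp only [p, hj]
      group
    have hmem : t ^ (-r (f * x)) * f * t ^ (r x) ∈ φ.ker := by
      have := φ.ker.mul_mem (hp (f * x)) (φ.ker.inv_mem (hp x))
      rwa [heq, mul_inv_cancel_right] at this
    simp only [Option.map_eq_some_iff, Prod.mk.injEq, ULift.up.injEq]
    refine ⟨i, ?_, hj, rfl⟩
    rw [← hc ⟨_, hmem⟩ ⟨_, ⟨_, (hr (f * x)).2, f, hf, rfl⟩, _, (hr x).1, rfl⟩]
    congr 1
    ext
    simpa using heq
  · intro x
    simpa using h3 _

/-- The distance of `h` to the multiples of `2 * T`. -/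
def triangleWave (T h : ℤ) : ℤ := min (h % (2 * T)) (2 * T - h % (2 * T))

/-- Slabs with index `(h + T) / (2 * T)` change only at odd multiples of `T`, where the wave is near
`T`; those with index `h / (2 * T)` change only at even multiples, where it is near `0`. -/
theorem triangleWave_spec {T L h h' : ℤ} (hT : 2 * L < T) (hL : 0 ≤ L) (hh : |h' - h| ≤ L) :
    |triangleWave T h' - triangleWave T h| ≤ L ∧
    (triangleWave T h < T - L → (h' + T) / (2 * T) = (h + T) / (2 * T)) ∧
    (L < triangleWave T h → h' / (2 * T) = h / (2 * T)) := by
  obtain ⟨hl, hu⟩ := abs_le.1 hh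
  have h0 : (0 : ℤ) < 2 * T := by lia
  have e := Int.emod_add_mul_ediv h (2 * T)
  have e1 := Int.emod_nonneg h h0.ne'
  have e2 := Int.emod_lt_of_pos h h0
  have e' := Int.emod_add_mul_ediv h' (2 * T)
  have e1' := Int.emod_nonneg h' h0.ne'
  have e2' := Int.emod_lt_of_pos h' h0
  unfold triangleWave
  set s := h % (2 * T)
  set s' := h' % (2 * T)
  set q := h / (2 * T)
  set q' := h' / (2 * T)
  have hcases : q' = q ∨ q' = q + 1 ∨ q' = q - 1 := by
    have h4 : 2 * T * (q' - q) < 2 * T * 2 := by linarith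
    have h5 : 2 * T * (q - q') < 2 * T * 2 := by linarith
    have := lt_of_mul_lt_mul_left h4 h0.le
    have := lt_of_mul_lt_mul_left h5 h0.le
    lia
  have hdiv : ∀ x k : ℤ, 2 * T * k ≤ x → x < 2 * T * k + 2 * T → x / (2 * T) = k := by
    intro x k h1 h2
    rw [Int.ediv_eq_iff_of_pos h0]
    constructor <;> linarith
  have hd : (h + T) / (2 * T) = if s < T then q else q + 1 := by
    split_ifs with hs <;> refine hdiv _ _ ?_ ?_ <;> linarith
  have hd' : (h' + T) / (2 * T) = if s' < T then q' else q' + 1 := by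
    split_ifs with hs <;> refine hdiv _ _ ?_ ?_ <;> linarith
  rw [hd, hd', abs_le]
  obtain hc | hc | hc := hcases
  · rw [hc] at e' ⊢
    clear_value s s' q q'
    generalize 2 * T * q = w at e e'
    refine ⟨by lia, fun _ => ?_, fun _ => rfl⟩
    split_ifs <;> lia
  · rw [hc, mul_add] at e'
    clear_value s s' q q'
    generalize 2 * T * q = w at e e'
    refine ⟨by lia, fun _ => ?_, fun _ => by lia⟩
    split_ifs <;> lia
  · rw [hc, mul_sub] at e'
    clear_value s s' q q'
    generalize 2 * T * q = w at e e'
    refine ⟨by lia, fun _ => ?_, fun _ => by lia⟩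
    split_ifs <;> lia

/-- If `G` maps onto `ℤ` and the kernel has coloured covers of multiplicity `n + 1`, then `G` has
coloured covers of multiplicity `n + 2`. Slabs around the even multiples of some height `T` carry a
cover of the required scale, slabs around the odd multiples carry a coarser cover. Between them, one
passes from the first cover to the second at a different height `τ c` for each colour `c`. -/
theorem HasColoredCovers.of_ker_int {n : ℕ} (φ : G →* Multiplicative ℤ) (t : G)
    (ht : (φ t).toAdd = 1) (h : HasColoredCovers n φ.ker) : HasColoredCovers (n + 1) G := by
  classical
  intro F hF
  obtain ⟨L, hL0, hL⟩ : ∃ L : ℤ, 0 ≤ L ∧ ∀ f ∈ F, |(φ f).toAdd| ≤ L := by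
    obtain ⟨L, hL⟩ := (hF.image fun f => |(φ f).toAdd|).bddAbove
    exact ⟨max L 0, le_max_right _ _, fun f hf => (hL ⟨f, hf, rfl⟩).trans (le_max_left _ _)⟩
  -- Spacing `2 * L + 1` makes the windows `[τ c - L, τ c + L]` disjoint. They lie strictly between
  -- `0` and `T₁`, and `T` leaves room for a step `L` on either side of `T₁ + L`.
  let τ : Fin (2 ^ n) → ℤ := fun c => (c + 1) * (2 * L + 1)
  let T₁ : ℤ := (2 ^ n + 1) * (2 * L + 1)
  let T : ℤ := T₁ + 2 * L + 1
  have hτL : ∀ c, L < τ c := fun c => by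
    simp only [τ]
    nlinarith [Int.natCast_nonneg c.1]
  have hτT : ∀ c, τ c + L < T₁ := fun c => by
    have hc : (c : ℤ) + 1 ≤ 2 ^ n := by exact_mod_cast c.2
    simp only [τ, T₁]
    nlinarith
  have hτ : ∀ c c' z, |z - τ c| ≤ L → |z - τ c'| ≤ L → c = c' := by
    intro c c' z h1 h2
    rw [abs_le] at h1 h2
    have hpos : (0 : ℤ) < 2 * L + 1 := by lia
    have h3 : (2 * L + 1) * ((c : ℤ) - c') < (2 * L + 1) * 1 := by
      simp only [τ] at h1 h2
      linarith
    have h4 : (2 * L + 1) * ((c' : ℤ) - c) < (2 * L + 1) * 1 := by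
      simp only [τ] at h1 h2
      linarith
    have := lt_of_mul_lt_mul_left h3 hpos.le
    have := lt_of_mul_lt_mul_left h4 hpos.le
    ext
    lia
  have hT₁ : 0 < T₁ := by simp only [T₁]; positivity
  have hT0 : 0 < 2 * T := by simp only [T]; lia
  obtain ⟨E', hE', ιE, ℓE, hEb, hEl, hEm⟩ := h.exists_slab_cover φ t ht hF hT0 T
  -- The scale includes `E'`, so that each piece of the first cover, cut to one slab of the second,
  -- lies in a single set of the second.
  obtain ⟨O', hO', ιO, ℓO, hOb, hOl, hOm⟩ := h.exists_slab_cover φ t ht (hF.union hE') hT0 0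
  let w : G → ℤ := fun x => triangleWave T (φ x).toAdd
  let k : G → ℤ := fun x => ((φ x).toAdd + 0) / (2 * T)
  have hstep : ∀ x, ∀ f ∈ F, |w (f * x) - w x| ≤ L ∧
      (w x < T - L → ((φ (f * x)).toAdd + T) / (2 * T) = ((φ x).toAdd + T) / (2 * T)) ∧
      (L < w x → k (f * x) = k x) := by
    intro x f hf
    simp only [w, k, add_zero]
    exact triangleWave_spec (by simp only [T]; lia) hL0 (by simpa using hL f hf)
  have hsub : ∀ c e q, ∃ c' o, ∀ y, ℓE c y = some e → k y = q → ℓO c' y = some o := by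
    intro c e q
    by_cases hne : ∃ x, ℓE c x = some e ∧ k x = q
    · obtain ⟨x, hx, hxq⟩ := hne
      obtain ⟨c', o, hc'⟩ := hOl x
      refine ⟨c', o, fun y hy hyq => ?_⟩
      have := hc' (y * x⁻¹) (Or.inr (hEb c y x e hy hx))
      rw [inv_mul_cancel_right] at this
      exact this (hyq.trans hxq.symm)
    · obtain ⟨c', o, -⟩ := hOl 1
      exact ⟨c', o, fun y hy hyq => absurd ⟨y, hy, hyq⟩ hne⟩
  choose Φ o hΦ using hsub
  -- Below height `T₁`, a set of the second cover is kept only at points of pieces assigned to it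
  -- that have reached their handover window. Both covers are present throughout the window, so a
  -- ball crossing it still lies in one set.
  let P : Fin (2 ^ n) → G → Prop := fun c' x =>
    T₁ ≤ w x ∨ ∃ c e, ℓE c x = some e ∧ τ c - L ≤ w x ∧ Φ c e (k x) = c'
  let ℓ : Fin (2 ^ n) ⊕ Fin (2 ^ n) → G → Option (ιE ⊕ ιO) := Sum.elim
    (fun c x => if w x ≤ τ c + L then (ℓE c x).map Sum.inl else none)
    (fun c x => if P c x then (ℓO c x).map Sum.inr else none)
  have hcover : IsColoredCover F (E' ∪ O') (n + 1 + 1) ℓ := by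
    refine ⟨?_, ?_, ?_⟩
    · rintro (c | c) x y (i | i) hx hy <;> simp [ℓ] at hx hy
      · exact Or.inl (hEb c x y i hx.2 hy.2)
      · exact Or.inr (hOb c x y i hx.2 hy.2)
    · intro x
      by_cases hw : T₁ + L ≤ w x
      · obtain ⟨c, i, hc⟩ := hOl x
        refine ⟨Sum.inr c, Sum.inr i, fun f hf => ?_⟩
        obtain ⟨h1, -, h3⟩ := hstep x f hf
        have hP : P c (f * x) := Or.inl (by rw [abs_le] at h1; lia)
        simp [ℓ, hP, hc f (Or.inl hf) (h3 (by lia))]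
      · obtain ⟨c, e, hc⟩ := hEl x
        have hce : ∀ f ∈ F, ℓE c (f * x) = some e := fun f hf =>
          hc f hf ((hstep x f hf).2.1 (by simp only [T]; lia))
        by_cases hwc : w x ≤ τ c
        · refine ⟨Sum.inl c, Sum.inl e, fun f hf => ?_⟩
          have hle : w (f * x) ≤ τ c + L := by
            have := (hstep x f hf).1
            rw [abs_le] at this
            lia
          simp [ℓ, hle, hce f hf]
        · refine ⟨Sum.inr (Φ c e (k x)), Sum.inr (o c e (k x)), fun f hf => ?_⟩
          obtain ⟨h1, -, h3⟩ := hstep x f hf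
          have hk : k (f * x) = k x := h3 (by have := hτL c; lia)
          have hP : P (Φ c e (k x)) (f * x) :=
            Or.inr ⟨c, e, hce f hf, by rw [abs_le] at h1; lia, by rw [hk]⟩
          simp [ℓ, hP, hΦ c e (k x) _ (hce f hf) hk]
    · intro x
      rw [Finset.card_filter, Fintype.sum_sum_type, ← Finset.card_filter, ← Finset.card_filter]
      by_cases hw : T₁ ≤ w x
      · have h0 : (Finset.univ.filter fun c => (ℓ (Sum.inl c) x).isSome) = ∅ := by
          refine Finset.filter_eq_empty_iff.2 fun c _ => ?_
          have : ¬ w x ≤ τ c + L := by have := hτT c; lia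
          simp [ℓ, this]
        have h1 : (Finset.univ.filter fun c => (ℓ (Sum.inr c) x).isSome) ⊆
            Finset.univ.filter fun c => (ℓO c x).isSome := by
          refine Finset.monotone_filter_right _ fun c _ hc => ?_
          by_contra hcon
          simp [ℓ, Option.not_isSome_iff_eq_none.1 hcon] at hc
        rw [h0, Finset.card_empty, zero_add]
        exact (Finset.card_le_card h1).trans ((hOm x).trans (Nat.le_succ _))
      -- Labels of the first cover inject into `A₁`, those of the second come from `A₂`, and `|A₁| +
      -- |A₂| = |A₁ ∪ A₂| + |A₁ ∩ A₂| ≤ (n + 1) + 1`.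
      · let A := Finset.univ.filter fun c => (ℓE c x).isSome
        let A₁ := A.filter fun c => w x ≤ τ c + L
        let A₂ := A.filter fun c => τ c - L ≤ w x
        have h1 : (Finset.univ.filter fun c => (ℓ (Sum.inl c) x).isSome) ⊆ A₁ := by
          intro c hc
          replace hc := (Finset.mem_filter.1 hc).2
          by_cases hwc : w x ≤ τ c + L <;> simp [ℓ, hwc] at hc
          simp [A₁, A, hc, hwc]
        have h2 : (Finset.univ.filter fun c => (ℓ (Sum.inr c) x).isSome) ⊆
            A₂.image fun c => if hc : (ℓE c x).isSome then Φ c ((ℓE c x).get hc) (k x) else c := by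
          intro c' hc'
          replace hc' := (Finset.mem_filter.1 hc').2
          by_cases hP : P c' x
          · obtain hP | ⟨c, e, hce, hwc, hc⟩ := hP
            · exact absurd hP hw
            · exact Finset.mem_image.2 ⟨c, by simp [A₂, A, hce]; lia, by simp [hce, hc]⟩
          · simp [ℓ, hP] at hc'
        have h3 : (A₁ ∩ A₂).card ≤ 1 := by
          refine Finset.card_le_one.2 fun c hc c' hc' => hτ c c' (w x) ?_ ?_
          · simp only [A₁, A₂, Finset.mem_inter, Finset.mem_filter] at hc
            rw [abs_le]
            lia
          · simp only [A₁, A₂, Finset.mem_inter, Finset.mem_filter] at hc'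
            rw [abs_le]
            lia
        have h4 : (A₁ ∪ A₂).card ≤ n + 1 :=
          (Finset.card_le_card (Finset.union_subset (Finset.filter_subset _ _)
            (Finset.filter_subset _ _))).trans (hEm x)
        have h5 := Finset.card_union_add_card_inter A₁ A₂
        have h6 := Finset.card_le_card h1
        have h7 := (Finset.card_le_card h2).trans Finset.card_image_le
        lia
  have hcard : Fintype.card (Fin (2 ^ n) ⊕ Fin (2 ^ n)) = 2 ^ (n + 1) := by
    simp [pow_succ, mul_two]
  exact ⟨_, hE'.union hO', _, _, hcover.extend (Fintype.equivFinOfCardEq hcard).toEmbedding⟩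

end IntegerQuotient

/-! ### Extensions by abelian and virtually abelian groups -/

theorem HasColoredCovers.of_injective_mem {G H : Type u} [Group G] [Group H] {n : ℕ}
    {K : Subgroup G} (h : HasColoredCovers n K) (φ : H →* G) (hφ : Function.Injective φ)
    (hK : ∀ x, φ x ∈ K) : HasColoredCovers n H :=
  h.of_injective (φ.codRestrict K hK) fun _ _ hxy => hφ (congrArg Subtype.val hxy)

theorem HasColoredCovers.of_ker_torsion {G A : Type u} [Group G] [CommGroup A] {n : ℕ}
    (φ : G →* A) (h : HasColoredCovers n φ.ker) (hφ : ∀ x, IsOfFinOrder (φ x)) :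
    HasColoredCovers n G := by
  refine hasColoredCovers_of_fg fun H hH => ?_
  let ψ : H →* A := φ.comp H.subtype
  have : Group.FG H := (Group.fg_iff_subgroup_fg H).2 hH
  have : Finite ψ.range := by
    refine CommGroup.finite_of_fg_isMulTorsion _ ?_
    rintro ⟨_, x, rfl⟩
    exact Submonoid.isOfFinOrder_coe.1 (hφ x)
  have hker : HasColoredCovers n ψ.ker :=
    h.of_injective_mem (H.subtype.comp ψ.ker.subtype)
      (Subtype.val_injective.comp Subtype.val_injective) fun x => x.2
  exact hker.of_finiteIndex inferInstance

theorem HasColoredCovers.of_ker_rat {G : Type u} [Group G] {n : ℕ} (φ : G →* Multiplicative ℚ)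
    (h : HasColoredCovers n φ.ker) : HasColoredCovers (n + 1) G := by
  refine hasColoredCovers_of_fg fun H hH => ?_
  have : Group.FG H := (Group.fg_iff_subgroup_fg H).2 hH
  let ψ : Additive H →+ ℚ := MonoidHom.toAdditiveLeft (φ.comp H.subtype)
  let I : Submodule ℤ ℚ := AddSubgroup.toIntSubmodule ψ.range
  have hI : I.FG := by
    rw [Submodule.fg_iff_addSubgroup_fg]
    exact (AddGroup.fg_iff_addSubgroup_fg _).1 (AddGroup.fg_range ψ)
  -- The image is a fractional ideal of the principal ideal domain `ℤ`, hence cyclic; dividing by a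
  -- nonzero generator gives a map onto `ℤ` with the same kernel.
  obtain ⟨q, hq⟩ : Submodule.IsPrincipal I := by
    have := FractionalIdeal.isPrincipal (R := ℤ) (K := ℚ)
      ⟨I, FractionalIdeal.isFractional_of_fg hI⟩
    exact this
  obtain ⟨t, ht⟩ : ∃ t : H, (φ t).toAdd = q := by
    have : q ∈ I := hq ▸ Submodule.mem_span_singleton_self q
    obtain ⟨t, ht⟩ := this
    exact ⟨t.toMul, ht⟩
  have hmul : ∀ x : H, ∃ e : ℤ, e • q = (φ x).toAdd := fun x => by
    have : (φ x).toAdd ∈ I := ⟨Additive.ofMul x, rfl⟩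
    rwa [hq, Submodule.mem_span_singleton] at this
  choose e he using hmul
  by_cases hq0 : q = 0
  · refine (h.of_injective_mem H.subtype Subtype.val_injective fun x => ?_).mono n.le_succ
    apply Multiplicative.toAdd.injective
    simp [← he, hq0]
  · let ε : H →* Multiplicative ℤ := MonoidHom.mk' (fun x => Multiplicative.ofAdd (e x)) <| by
      intro x y
      apply Multiplicative.toAdd.injective
      apply smul_left_injective ℤ hq0
      simp [he, add_smul]
    refine HasColoredCovers.of_ker_int ε t ?_ (h.of_injective_mem
      (H.subtype.comp ε.ker.subtype) (Subtype.val_injective.comp Subtype.val_injective) ?_)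
    · apply smul_left_injective ℤ hq0
      simp [ε, he, ht]
    · rintro ⟨x, hx⟩
      have hx : e x = 0 := hx
      apply Multiplicative.toAdd.injective
      simp [← he, hx]

theorem HasColoredCovers.of_ker_fin_rat {n r : ℕ} : ∀ {G : Type u} [Group G]
    (φ : G →* Multiplicative (Fin r → ℚ)), HasColoredCovers n φ.ker →
    HasColoredCovers (n + r) G := by
  induction r generalizing n with
  | zero =>
    intro G _ φ h
    exact h.of_injective_mem (MonoidHom.id G) Function.injective_id fun x => Subsingleton.elim _ _
  | succ r ih =>
    intro G _ φ h
    let tail : (Fin (r + 1) → ℚ) →+ (Fin r → ℚ) :=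
      AddMonoidHom.pi fun i => Pi.evalAddMonoidHom _ i.succ
    let ψ : G →* Multiplicative (Fin r → ℚ) := tail.toMultiplicative.comp φ
    let χ : ψ.ker →* Multiplicative ℚ :=
      ((Pi.evalAddMonoidHom (fun _ : Fin (r + 1) => ℚ) 0).toMultiplicative.comp φ).comp
        ψ.ker.subtype
    have hχ : HasColoredCovers n χ.ker := by
      refine h.of_injective_mem (ψ.ker.subtype.comp χ.ker.subtype)
        (Subtype.val_injective.comp Subtype.val_injective) ?_
      rintro ⟨⟨x, hx⟩, hx0⟩
      apply Multiplicative.toAdd.injective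
      funext i
      refine Fin.cases ?_ (fun i => ?_) i
      · exact congrArg Multiplicative.toAdd hx0
      · exact congrFun (congrArg Multiplicative.toAdd hx) i
    have := ih ψ hχ.of_ker_rat
    rwa [add_assoc, add_comm 1 r] at this

theorem HasColoredCovers.of_ker_abelian {G A : Type u} [Group G] [CommGroup A] {n r : ℕ}
    (φ : G →* A) (h : HasColoredCovers n φ.ker) (hr : abelianRank A ≤ r) :
    HasColoredCovers (n + r) G := by
  have hrank : Module.rank ℚ (ℚ ⊗[ℤ] Additive A) ≤ r := Cardinal.toENat_le_natCast.1 hr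
  have : Module.Finite ℚ (ℚ ⊗[ℤ] Additive A) :=
    Module.rank_lt_aleph0_iff.1 (hrank.trans_lt (Cardinal.natCast_lt_aleph0))
  have hfin : Module.finrank ℚ (ℚ ⊗[ℤ] Additive A) ≤ r := by
    rw [← Module.finrank_eq_rank] at hrank
    exact_mod_cast hrank
  let e := (Module.finBasis ℚ (ℚ ⊗[ℤ] Additive A)).equivFun
  let β : Additive A →+ (Fin (Module.finrank ℚ (ℚ ⊗[ℤ] Additive A)) → ℚ) :=
    e.toLinearMap.toAddMonoidHom.comp (TensorProduct.mk ℤ ℚ (Additive A) 1).toAddMonoidHom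
  let ψ : G →* Multiplicative (Fin (Module.finrank ℚ (ℚ ⊗[ℤ] Additive A)) → ℚ) :=
    (AddMonoidHom.toMultiplicativeRight β).comp φ
  have htors : ∀ x : G, ψ x = 1 → IsOfFinOrder (φ x) := by
    intro x hx
    have hx : e (TensorProduct.mk ℤ ℚ (Additive A) 1 (Additive.ofMul (φ x))) = 0 := hx
    -- `ℚ ⊗ A` is the localization of `A` at the nonzero integers, so an element that dies there is
    -- torsion.
    rw [e.map_eq_zero_iff, IsLocalizedModule.eq_zero_iff (nonZeroDivisors ℤ)] at hx
    obtain ⟨s, hs⟩ := hx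
    rw [isOfFinOrder_iff_zpow_eq_one]
    exact ⟨s, nonZeroDivisors.ne_zero s.2, hs⟩
  have hψ : HasColoredCovers n ψ.ker := by
    refine HasColoredCovers.of_ker_torsion (φ.comp ψ.ker.subtype) ?_ fun x => htors x x.2
    exact h.of_injective_mem (ψ.ker.subtype.comp (Subgroup.subtype _))
      (Subtype.val_injective.comp Subtype.val_injective) fun x => x.2
  exact (HasColoredCovers.of_ker_fin_rat ψ hψ).mono (by lia)

open IsMulCommutative in
theorem HasColoredCovers.of_virtuallyAbelian_quotient {G : Type u} [Group G] {n r : ℕ}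
    {N : Subgroup G} [N.Normal] (h : HasColoredCovers n N) (A : Subgroup (G ⧸ N))
    [IsMulCommutative A] (hA : A.FiniteIndex) (hr : abelianRank A ≤ r) :
    HasColoredCovers (n + r) G := by
  let B : Subgroup G := A.comap (QuotientGroup.mk' N)
  let φ : B →* A := (QuotientGroup.mk' N).subgroupComap A
  have hφ : HasColoredCovers n φ.ker := by
    refine h.of_injective_mem (B.subtype.comp φ.ker.subtype)
      (Subtype.val_injective.comp Subtype.val_injective) fun x => ?_
    exact (QuotientGroup.eq_one_iff _).1 (congrArg Subtype.val x.2)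
  exact (hφ.of_ker_abelian φ hr).of_finiteIndex ⟨by
    rw [Subgroup.index_comap_of_surjective _ (QuotientGroup.mk'_surjective N)]
    exact hA.index_ne_zero⟩

/-! ### Induction along the Hirsch length -/

open IsMulCommutative in
theorem HasHirschLengthAt.exists_eq_abelianRank {G : Type u} [Group G] {m : ℕ∞}
    (h : HasHirschLengthAt 1 G m) :
    ∃ (A : Subgroup G) (_ : IsMulCommutative A), A.FiniteIndex ∧ m = abelianRank A := by
  generalize hβ : (1 : Ordinal.{u}) = β at h
  cases h with
  | trivial => exact absurd hβ one_ne_zero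
  | virtuallyAbelian _ A hA => exact ⟨A, inferInstance, hA, rfl⟩
  | succ α hα =>
    have : (1 : Ordinal.{u}) < α + 1 := Order.lt_add_one_iff.2 hα
    exact absurd hβ this.ne
  | limit _ h =>
    rw [← hβ, ← zero_add 1] at h
    exact absurd h (Order.not_isSuccLimit_succ 0)

open IsMulCommutative in
theorem HasHirschLengthAt.hasColoredCovers {α : Ordinal.{u}} {G : Type u} [Group G] {m : ℕ∞}
    (h : HasHirschLengthAt α G m) : ∀ k : ℕ, m ≤ k → HasColoredCovers k G := by
  induction h with
  | trivial G hG => exact fun k _ => (hasColoredCovers_of_subsingleton G).mono k.zero_le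
  | virtuallyAbelian G A hA =>
    intro k hk
    have h0 : HasColoredCovers 0 (MonoidHom.id A).ker :=
      (hasColoredCovers_of_subsingleton PUnit.{u + 1}).of_injective 1 fun x y _ =>
        Subtype.ext (x.2.trans y.2.symm)
    simpa using (h0.of_ker_abelian _ hk).of_finiteIndex hA
  | succ α hα G N hN v hv m hm ihv ihm =>
    intro k hk
    obtain ⟨A, _, hA, rfl⟩ := hm.exists_eq_abelianRank
    obtain ⟨s, hs⟩ := ENat.ne_top_iff_exists.1 ((le_self_add.trans hk).trans_lt
      (ENat.natCast_lt_top k)).ne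
    obtain ⟨r, hr⟩ := ENat.ne_top_iff_exists.1 ((le_add_self.trans hk).trans_lt
      (ENat.natCast_lt_top k)).ne
    have hNs : HasColoredCovers s N := hasColoredCovers_of_fg fun F hF =>
      ihv F (hN F hF) s (hs ▸ le_iSup₂_of_le F (hN F hF) le_rfl)
    rw [← hs, ← hr] at hk
    exact (hNs.of_virtuallyAbelian_quotient A hA hr.ge).mono (by exact_mod_cast hk)
  | limit β hβ α hα G n hG ih => exact ih

theorem mainTheorem6 (G : Type u) [Group G] (hG : IsElementaryAmenable G) :
    groupAsdim G ≤ hirschLength G ∧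
      ∀ [MetricSpace G], IsProperRightInvariant G → metricAsdim G ≤ hirschLength G := by
  have key : ∀ k : ℕ, hirschLength G = k → GroupAsdimLE G k := by
    intro k hk
    obtain ⟨α, hα⟩ := hG
    obtain ⟨n, hn⟩ := hα.exists_hasHirschLengthAt
    -- A nonempty set in `ℕ∞` attains its infimum, so one derivation realizes `hirschLength G` and
    -- independence of choices is not needed.
    obtain ⟨β, hβ⟩ := csInf_mem (s := {n : ℕ∞ | ∃ α : Ordinal.{u}, HasHirschLengthAt α G n})
      ⟨n, α, hn⟩
    exact (hβ.hasColoredCovers k hk.le).groupAsdimLE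
  by_cases htop : hirschLength G = ⊤
  · simp [htop]
  · obtain ⟨k, hk⟩ := ENat.ne_top_iff_exists.1 htop
    replace hk := hk.symm
    rw [hk]
    exact ⟨iInf₂_le k (key k hk), fun hd => iInf₂_le k ((key k hk).metricAsdimLE hd)⟩
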